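/- Let $X$ and $Y$ be Polish spaces, $\mu\in\mathcal P(X)$ and $\nu\in\mathcal P(Y)$ Borel probability measures, and $c\colon X\times Y\to\mathbb R_+$ a continuous cost function with $T_c(\mu,\nu)=\inf_{\pi}\int c\,d\pi<\infty$, the infimum being over all transport plans (couplings) $\pi$ of $\mu$ and $\nu$; a plan attaining it is called optimal. For $f\colon X\to\mathbb R\cup\{-\infty\}$ put $f^c(y)=\inf_{x\in X}\big(c(x,y)-f(x)\big)$, and for $g\colon Y\to\mathbb R\cup\{-\infty\}$ put $g^c(x)=\inf_{y\in Y}\big(c(x,y)-g(y)\big)$. A function $f\colon X\to\mathbb R\cup\{-\infty\}$, not identically $-\infty$, is $c$-concave if $f=g^c$ for some $g\colon Y\to\mathbb R\cup\{-\infty\}$. A (generalized) Kantorovich potential is a $c$-concave $f$ for which there is an optimal plan $\pi$ such that $f(x)+f^c(y)$ is $\pi$-almost surely finite and $\pi$-integrable with $\int \big(f(x)+f^c(y)\big)\,d\pi(x,y)=\int c\,d\pi=T_c(\mu,\nu)$. Kantorovich potentials are called almost surely unique if for any two of them, $f_1$ and $f_2$, there is $a\in\mathbb R$ with $f_1-f_2=a$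 $\mu$-almost surely. Suppose that $\operatorname{supp}\mu=\bigcup_{i\in I}X_i$ and $\operatorname{supp}\nu=\bigcup_{j\in J}Y_j$ are the decompositions into (distinct) connected components, where $I$ and $J$ are at most countable. A transport plan $\pi$ is degenerate if there are $I'\subset I$ and $J'\subset J$ with $$0<\sum_{i\in I'}\mu(X_i)=\sum_{i\in I'}\sum_{j\in J'}\pi(X_i\times Y_j)=\sum_{j\in J'}\nu(Y_j)<1 .$$ Given an optimal plan $\pi$ and $i\in I$ with $\mu(X_i)>0$, the $X_i$-restricted problem with respect to $\pi$ is the transport problem on $X_i\times Y$ with cost $c|_{X_i\times Y}$ between $\mu|_{X_i}/\mu(X_i)$ and $\pi(X_i\times\cdot)/\mu(X_i)$. Consider the regularity condition (R) for every $j\in J$ with $\nu(Y_j)>0$, the set $\operatorname{supp}(\nu|_{Y_j})$ is connected, and for every Kantorovich potential $f$ the function $f^c|_{Y_j}$ is real-valued (finite) and continuous. Then the following hold. (a) Let $\pi$ be a non-degenerate optimal transport plan such that, for every $i\in I$ with $\mu(X_i)>0$, the Kantorovich potentials of the $X_i$-restricted problem with respect to $\pi$ are almost surely unique. If either (1) condition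 (R) holds and for every $j\in J$ the set $\{i\in I : \pi(X_i\times Y_j)>0\}$ is finite, or (2) $Y_j$ consists of a single point for every $j\in J$ with $\nu(Y_j)>0$, then the Kantorovich potentials for $\mu$, $\nu$ and $c$ are almost surely unique. (b) Assumption (2) always implies condition (R). (c) Suppose that (2) holds, that every $X_i$ is a single point, and that $\sum_{i\in I'}\mu(X_i)\neq\sum_{j\in J'}\nu(Y_j)$ for all nonempty proper subsets $I'\subset I$ and $J'\subset J$. Then the Kantorovich potentials for $\mu$, $\nu$ and $c$ are almost surely unique. -/

import Mathlib

open MeasureTheory Set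
open scoped ENNReal NNReal

noncomputable section

namespace OptimalTransport

section Potentials

variable {X Y : Type*}

/-- The `c`-transform `f^c(y) = inf_x (c(x, y) - f(x))` of an extended-valued `f` on `X`.
The transform of a function on `Y` is the transform with respect to the swapped cost. -/
def cTransform (c : X × Y → ℝ≥0) (f : X → EReal) : Y → EReal :=
  fun y => ⨅ x, (((c (x, y) : ℝ) : EReal) - f x)

/-- `f : X → ℝ ∪ {-∞}` is `c`-concave on `X`: it equals `g^c` for some `g : Y → ℝ ∪ {-∞}` and is
not equal to `-∞` everywhere. -/
def IsCConcave (c : X × Y → ℝ≥0) (f : X → EReal) : Prop :=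
  (∀ x, f x ≠ ⊤) ∧ (∃ x, f x ≠ ⊥) ∧
    ∃ g : Y → EReal, (∀ y, g y ≠ ⊤) ∧ f = cTransform (fun p : Y × X => c (p.2, p.1)) g

variable [MeasurableSpace X] [MeasurableSpace Y]

/-- `π` is a transport plan between `μ` and `ν`. -/
def IsPlan (μ : Measure X) (ν : Measure Y) (π : Measure (X × Y)) : Prop :=
  π.fst = μ ∧ π.snd = ν

/-- The optimal transport cost `T_c(μ, ν) = inf_π ∫ c dπ`. -/
def transportCost (c : X × Y → ℝ≥0) (μ : Measure X) (ν : Measure Y) : ℝ≥0∞ :=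
  ⨅ (π : Measure (X × Y)) (_ : IsPlan μ ν π), ∫⁻ p, (c p : ℝ≥0∞) ∂π

/-- `π` is an optimal transport plan. -/
def IsOptimalPlan (c : X × Y → ℝ≥0) (μ : Measure X) (ν : Measure Y)
    (π : Measure (X × Y)) : Prop :=
  IsPlan μ ν π ∧ ∫⁻ p, (c p : ℝ≥0∞) ∂π = transportCost c μ ν

/-- `f` is a (generalized) Kantorovich potential: `f` is `c`-concave and
`T_c(μ, ν) = π c = π (f ⊕ f^c)` for some optimal plan `π`, where `f ⊕ f^c` is required to be
`π`-almost surely finite and `π`-integrable. -/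
def IsKantorovichPotential (c : X × Y → ℝ≥0) (μ : Measure X) (ν : Measure Y)
    (f : X → EReal) : Prop :=
  IsCConcave c f ∧ ∃ π : Measure (X × Y), IsOptimalPlan c μ ν π ∧
    (∀ᵐ p ∂π, f p.1 + cTransform c f p.2 ≠ ⊥) ∧
    Integrable (fun p : X × Y => (f p.1 + cTransform c f p.2).toReal) π ∧
    ((∫ p, (f p.1 + cTransform c f p.2).toReal ∂π : ℝ) : EReal)
      = ((transportCost c μ ν : ℝ≥0∞) : EReal)

/-- Kantorovich potentials are almost surely unique (up to constant shifts): the difference of any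
two of them is `μ`-almost surely equal to a real constant. -/
def PotentialsAEUnique (c : X × Y → ℝ≥0) (μ : Measure X) (ν : Measure Y) : Prop :=
  ∀ f₁ f₂ : X → EReal, IsKantorovichPotential c μ ν f₁ → IsKantorovichPotential c μ ν f₂ →
    ∃ a : ℝ, ∀ᵐ x ∂μ, f₁ x - f₂ x = (a : EReal)

/-- The cost `c` restricted to `S × Y`. -/
def restrictedCost (c : X × Y → ℝ≥0) (S : Set X) : S × Y → ℝ≥0 :=
  fun p => c ((p.1 : X), p.2)

/-- The probability measure `μ|_S / μ(S)`, as a measure on the subspace `S`. -/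
def restrictedSource (μ : Measure X) (S : Set X) : Measure S :=
  (μ S)⁻¹ • μ.comap (Subtype.val : S → X)

/-- The probability measure `π(S × ·) / μ(S)` on `Y`. -/
def restrictedTarget (μ : Measure X) (π : Measure (X × Y)) (S : Set X) : Measure Y :=
  (μ S)⁻¹ • (π.restrict (S ×ˢ (univ : Set Y))).snd

/-- Almost sure uniqueness of the Kantorovich potentials of the `S`-restricted problem with
respect to the plan `π`. -/
def RestrictedPotentialsAEUnique (c : X × Y → ℝ≥0) (μ : Measure X) (π : Measure (X × Y))
    (S : Set X) : Prop :=
  PotentialsAEUnique (restrictedCost c S) (restrictedSource μ S) (restrictedTarget μ π S)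

/-- The plan `π` is degenerate with respect to the decompositions `A` and `B`. -/
def IsDegenerate {I J : Type*} (μ : Measure X) (ν : Measure Y) (π : Measure (X × Y))
    (A : I → Set X) (B : J → Set Y) : Prop :=
  ∃ (I' : Set I) (J' : Set J),
    0 < ∑' i : I', μ (A i) ∧
    ∑' i : I', μ (A i) = ∑' i : I', ∑' j : J', π (A i ×ˢ B j) ∧
    ∑' i : I', ∑' j : J', π (A i ×ˢ B j) = ∑' j : J', ν (B j) ∧
    ∑' j : J', ν (B j) < 1

/-- For every component `B j` of positive mass, all conjugate potentials `f^c` are finite and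
continuous on `B j`, and the support of `ν` restricted to `B j` is connected. -/
def ComponentwiseRegular [TopologicalSpace Y] {J : Type*} (c : X × Y → ℝ≥0) (μ : Measure X)
    (ν : Measure Y) (B : J → Set Y) : Prop :=
  ∀ j, 0 < ν (B j) →
    (∀ f : X → EReal, IsKantorovichPotential c μ ν f →
      ∃ h : Y → ℝ, ContinuousOn h (B j) ∧ ∀ y ∈ B j, cTransform c f y = (h y : EReal)) ∧
    IsConnected (ν.restrict (B j)).support

end Potentials

/-- `A` enumerates, without repetition, the connected components of the set `S`. -/
def IsComponentDecomposition {Z I : Type*} [TopologicalSpace Z] (S : Set Z) (A : I → Set Z) :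
    Prop :=
  Function.Injective A ∧ range A = {C | ∃ z ∈ S, C = connectedComponentIn S z}

end OptimalTransport

end

/-! Let `f₁`, `f₂` be potentials and `π` the given optimal plan. The integral of `f ⊕ f^c` depends
only on the marginals, so a potential witnessed by one optimal plan satisfies `f ⊕ f^c = c` almost
surely for every optimal plan (`IsKantorovichPotential.saturatesAE`). Conversely, such saturation
makes a finite-cost plan optimal and `f` a potential. As saturation survives restriction to `A i ×
Y`, potentials restrict to potentials (`IsKantorovichPotential.restrict`), and the hypothesis on the
restricted problems gives `f₁ - f₂ = a i` on `A i`.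

Subtracting the saturation identities gives `f₂^c - f₁^c = a i` wherever mass from `A i` lands. If
`A i` and `A i'` both send mass to `B j`, then `a i = a i'`: at a single point this is evaluation;
otherwise a continuous function with finitely many values on a connected support is constant
(`eq_of_pos_of_finite`).

Finally, the components sharing one constant exchange mass only with the targets they reach.
Non-degeneracy forces this closed subsystem to have full mass (`exists_eq_of_not_isDegenerate`), so
a single constant remains. -/

namespace OptimalTransport

open Filter Topology

/-! ### The `c`-transform: duality inequality, restriction, measurability -/

section Transform

variable {X Y : Type*} {c : X × Y → ℝ≥0} {f : X → EReal}

theorem add_cTransform_le (hf : ∀ x, f x ≠ ⊤) (x : X) (y : Y) :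
    f x + cTransform c f y ≤ ((c (x, y) : ℝ) : EReal) := by
  have h : cTransform c f y ≤ ((c (x, y) : ℝ) : EReal) - f x := iInf_le _ x
  induction hx : f x using EReal.rec with
  | bot => simp
  | top => exact absurd hx (hf x)
  | coe a =>
    rw [hx] at h
    calc (a : EReal) + cTransform c f y ≤ a + (((c (x, y) : ℝ) : EReal) - a) := by gcongr
      _ = ((c (x, y) : ℝ) : EReal) := by
        rw [← EReal.coe_sub, ← EReal.coe_add]; congr 1; ring

theorem cTransform_ne_top (hf : ∃ x, f x ≠ ⊥) (y : Y) : cTransform c f y ≠ ⊤ := by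
  obtain ⟨x, hx⟩ := hf
  have h : cTransform c f y ≤ ((c (x, y) : ℝ) : EReal) - f x := iInf_le _ x
  intro htop
  rw [htop, top_le_iff] at h
  induction hx' : f x using EReal.rec with
  | bot => exact hx hx'
  | top => simp [hx'] at h
  | coe a => rw [hx', ← EReal.coe_sub] at h; exact EReal.coe_ne_top _ h

theorem cTransform_le_restrictedCost (S : Set X) (y : Y) :
    cTransform c f y ≤ cTransform (restrictedCost c S) (fun x : S => f x) y :=
  le_iInf fun x => iInf_le _ (x : X)

theorem IsCConcave.toReal_add_le (hf : IsCConcave c f) {x : X} {y : Y} (hx : f x ≠ ⊥)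
    (hy : cTransform c f y ≠ ⊥) : (f x).toReal + (cTransform c f y).toReal ≤ c (x, y) := by
  rw [← EReal.coe_le_coe_iff, EReal.coe_add, EReal.coe_toReal (hf.1 x) hx,
    EReal.coe_toReal (cTransform_ne_top hf.2.1 y) hy]
  exact add_cTransform_le hf.1 x y

theorem IsCConcave.restrict {S : Set X} (hcc : IsCConcave c f) (hne : ∃ x ∈ S, f x ≠ ⊥) :
    IsCConcave (restrictedCost c S) (fun x : S => f x) := by
  obtain ⟨htop, -, g, hg, rfl⟩ := hcc
  obtain ⟨x, hx, hfx⟩ := hne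
  exact ⟨fun x => htop x, ⟨⟨x, hx⟩, hfx⟩, g, hg, rfl⟩

variable [TopologicalSpace X] [TopologicalSpace Y]

/-- An infimum of continuous functions is upper semicontinuous, even over an uncountable index and
with no regularity of `f`. -/
theorem measurable_cTransform [MeasurableSpace Y] [BorelSpace Y] (hc : Continuous c)
    (f : X → EReal) : Measurable (cTransform c f) := by
  refine UpperSemicontinuous.measurable (upperSemicontinuous_iInf fun x => ?_)
  have h : Continuous fun y : Y => ((c (x, y) : ℝ) : EReal) :=
    continuous_coe_real_ereal.comp (NNReal.continuous_coe.comp (hc.comp (by fun_prop)))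
  apply Continuous.upperSemicontinuous
  induction hx : f x using EReal.rec with
  | bot => simpa [hx] using continuous_const
  | top => simpa [hx] using continuous_const
  | coe a =>
    have h' : Continuous fun y : Y => (((c (x, y) : ℝ) - a : ℝ) : EReal) :=
      continuous_coe_real_ereal.comp
        ((NNReal.continuous_coe.comp (hc.comp (by fun_prop))).sub continuous_const)
    simpa [hx] using h'

theorem IsCConcave.measurable [MeasurableSpace X] [BorelSpace X] (hc : Continuous c)
    (hf : IsCConcave c f) : Measurable f := by
  obtain ⟨-, -, g, -, rfl⟩ := hf
  exact measurable_cTransform (hc.comp (by fun_prop)) g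

end Transform

/-! ### Integrals of direct sums depend only on the marginals -/

section Truncation

/-- Truncation of a real number to the interval `[-n, n]`. -/
def truncate (n : ℕ) (t : ℝ) : ℝ := max (-n) (min n t)

theorem abs_truncate_le (n : ℕ) (t : ℝ) : |truncate n t| ≤ n := by
  have : (0 : ℝ) ≤ n := n.cast_nonneg
  unfold truncate
  grind

/-- Truncation is odd and 1-Lipschitz; compare its values at `s` and `-t`. -/
theorem abs_truncate_add_le (n : ℕ) (s t : ℝ) : |truncate n s + truncate n t| ≤ |s + t| := by
  have : (0 : ℝ) ≤ n := n.cast_nonneg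
  unfold truncate
  grind

theorem truncate_add_le (n : ℕ) {s t r : ℝ} (hr : 0 ≤ r) (h : s + t ≤ r) :
    truncate n s + truncate n t ≤ r := by
  have : (0 : ℝ) ≤ n := n.cast_nonneg
  unfold truncate
  grind

theorem tendsto_truncate (t : ℝ) : Tendsto (fun n => truncate n t) atTop (𝓝 t) := by
  obtain ⟨N, hN⟩ := exists_nat_ge |t|
  refine tendsto_const_nhds.congr' ?_
  filter_upwards [eventually_ge_atTop N] with n hn
  have : (N : ℝ) ≤ n := by exact_mod_cast hn
  unfold truncate
  grind

theorem measurable_truncate (n : ℕ) : Measurable (truncate n) := by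
  unfold truncate; fun_prop

variable {X Y : Type*} [MeasurableSpace X] [MeasurableSpace Y]

theorem integrable_truncate_comp {Z : Type*} [MeasurableSpace Z] {ρ : Measure Z}
    [IsFiniteMeasure ρ] {U : Z → ℝ} (hU : Measurable U) (n : ℕ) :
    Integrable (fun z => truncate n (U z)) ρ :=
  Integrable.of_bound ((measurable_truncate n).comp hU).aestronglyMeasurable n
    (ae_of_all _ fun _ => abs_truncate_le n _)

theorem integral_truncate_add {π : Measure (X × Y)} [IsFiniteMeasure π]
    {U : X → ℝ} {V : Y → ℝ} (hU : Measurable U) (hV : Measurable V) (n : ℕ) :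
    ∫ p, (truncate n (U p.1) + truncate n (V p.2)) ∂π
      = ∫ x, truncate n (U x) ∂π.fst + ∫ y, truncate n (V y) ∂π.snd := by
  have hU' : Integrable (fun p : X × Y => truncate n (U p.1)) π :=
    integrable_truncate_comp (hU.comp measurable_fst) n
  have hV' : Integrable (fun p : X × Y => truncate n (V p.2)) π :=
    integrable_truncate_comp (hV.comp measurable_snd) n
  have hUm : Measurable fun x => truncate n (U x) := (measurable_truncate n).comp hU
  have hVm : Measurable fun y => truncate n (V y) := (measurable_truncate n).comp hV
  rw [integral_add hU' hV', Measure.fst, Measure.snd,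
    integral_map measurable_fst.aemeasurable hUm.aestronglyMeasurable,
    integral_map measurable_snd.aemeasurable hVm.aestronglyMeasurable]

theorem tendsto_integral_truncate_add {π : Measure (X × Y)}
    {U : X → ℝ} {V : Y → ℝ} (hU : Measurable U) (hV : Measurable V)
    (h : Integrable (fun p : X × Y => U p.1 + V p.2) π) :
    Tendsto (fun n => ∫ p, (truncate n (U p.1) + truncate n (V p.2)) ∂π) atTop
      (𝓝 (∫ p, (U p.1 + V p.2) ∂π)) := by
  refine tendsto_integral_of_dominated_convergence (fun p => |U p.1 + V p.2|)
    (fun n => ?_) h.abs (fun n => ae_of_all _ fun p => abs_truncate_add_le n _ _)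
    (ae_of_all _ fun p => (tendsto_truncate _).add (tendsto_truncate _))
  have := measurable_truncate n
  fun_prop

/-- If a direct sum `U ⊕ V` is bounded from above by an integrable function, then integrability
and the value of the integral depend only on the marginals of the plan. -/
theorem integrable_add_and_integral_eq {π π' : Measure (X × Y)} [IsFiniteMeasure π]
    [IsFiniteMeasure π'] (h₁ : π'.fst = π.fst) (h₂ : π'.snd = π.snd)
    {U : X → ℝ} {V : Y → ℝ} (hU : Measurable U) (hV : Measurable V) {C : X × Y → ℝ}
    (hC : ∀ p, 0 ≤ C p) (hCi : Integrable C π') (hle : ∀ᵐ p ∂π', U p.1 + V p.2 ≤ C p)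
    (hi : Integrable (fun p : X × Y => U p.1 + V p.2) π) :
    Integrable (fun p : X × Y => U p.1 + V p.2) π' ∧
      ∫ p, (U p.1 + V p.2) ∂π' = ∫ p, (U p.1 + V p.2) ∂π := by
  -- `U` and `V` need not be integrable separately, so the integral is split into marginal parts
  -- only after truncation.
  set W : ℕ → X × Y → ℝ := fun n p => truncate n (U p.1) + truncate n (V p.2) with hW
  have hWm : ∀ n, Measurable (W n) := fun n => by
    have := measurable_truncate n
    fun_prop
  have hWi : ∀ n, ∀ ρ : Measure (X × Y), IsFiniteMeasure ρ → Integrable (W n) ρ :=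
    fun n ρ _ => (integrable_truncate_comp (hU.comp measurable_fst) n).add
      (integrable_truncate_comp (hV.comp measurable_snd) n)
  have hWeq : ∀ n, ∫ p, W n p ∂π' = ∫ p, W n p ∂π := fun n => by
    rw [integral_truncate_add hU hV, integral_truncate_add hU hV, h₁, h₂]
  have hbound : ∀ n, ∫⁻ p, ‖W n p‖ₑ ∂π'
      ≤ ENNReal.ofReal (2 * ∫ p, C p ∂π' + ∫ p, |U p.1 + V p.2| ∂π) := by
    intro n
    rw [← ofReal_integral_norm_eq_lintegral_enorm (hWi n π' inferInstance)]
    apply ENNReal.ofReal_le_ofReal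
    -- Pointwise `|W| ≤ 2C - W`, because `W ≤ C` and `0 ≤ C`. The integral of `W` can then be moved
    -- to `π`, where `|U ⊕ V|` dominates.
    have h1 : ∫ p, ‖W n p‖ ∂π' ≤ ∫ p, (2 * C p - W n p) ∂π' := by
      refine integral_mono_ae (hWi n π' inferInstance).norm
        ((hCi.const_mul 2).sub (hWi n π' inferInstance)) ?_
      filter_upwards [hle] with p hp
      have h3 := truncate_add_le n (hC p) hp
      have h4 := hC p
      simp only [hW, Real.norm_eq_abs]
      grind
    rw [integral_sub (hCi.const_mul 2) (hWi n π' inferInstance), integral_const_mul, hWeq] at h1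
    have h2 : -∫ p, W n p ∂π ≤ ∫ p, |U p.1 + V p.2| ∂π := by
      rw [← integral_neg]
      refine integral_mono (hWi n π inferInstance).neg hi.abs fun p => ?_
      exact (neg_le_abs _).trans (abs_truncate_add_le n _ _)
    linarith
  -- Fatou's lemma turns the bound uniform in `n` into integrability.
  have hi' : Integrable (fun p : X × Y => U p.1 + V p.2) π' := by
    refine ⟨by fun_prop, ?_⟩
    have hlim : ∀ p : X × Y, liminf (fun n => ‖W n p‖ₑ) atTop = ‖U p.1 + V p.2‖ₑ := fun p =>
      ((tendsto_truncate (U p.1)).add (tendsto_truncate (V p.2))).enorm.liminf_eq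
    calc ∫⁻ p, ‖U p.1 + V p.2‖ₑ ∂π' = ∫⁻ p, liminf (fun n => ‖W n p‖ₑ) atTop ∂π' := by
          simp_rw [hlim]
      _ ≤ liminf (fun n => ∫⁻ p, ‖W n p‖ₑ ∂π') atTop :=
          lintegral_liminf_le fun n => (hWm n).enorm
      _ ≤ ENNReal.ofReal (2 * ∫ p, C p ∂π' + ∫ p, |U p.1 + V p.2| ∂π) :=
          liminf_le_of_le (h := fun b hb => by
            obtain ⟨n, hn⟩ := hb.exists
            exact hn.trans (hbound n))
      _ < ⊤ := ENNReal.ofReal_lt_top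
  refine ⟨hi', tendsto_nhds_unique (tendsto_integral_truncate_add hU hV hi') ?_⟩
  exact (tendsto_integral_truncate_add hU hV hi).congr fun n => (hWeq n).symm

end Truncation

/-! ### Potentials and almost sure saturation -/

section Optimality

variable {X Y : Type*} [MeasurableSpace X] [MeasurableSpace Y]
  {c : X × Y → ℝ≥0} {μ : Measure X} {ν : Measure Y} {π : Measure (X × Y)} {f : X → EReal}

/-- `f` and `f^c` are finite and add up to the cost `π`-almost surely. -/
def SaturatesAE (c : X × Y → ℝ≥0) (π : Measure (X × Y)) (f : X → EReal) : Prop :=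
  ∀ᵐ p ∂π, f p.1 ≠ ⊥ ∧ cTransform c f p.2 ≠ ⊥ ∧
    (f p.1).toReal + (cTransform c f p.2).toReal = c p

theorem IsPlan.isFiniteMeasure [IsFiniteMeasure μ] (hπ : IsPlan μ ν π) : IsFiniteMeasure π := by
  refine ⟨?_⟩
  rw [← Measure.fst_univ, hπ.1]
  exact measure_lt_top μ univ

theorem ae_fst_iff {s : Set X} (hs : MeasurableSet s) :
    (∀ᵐ p ∂π, p.1 ∈ s) ↔ ∀ᵐ x ∂π.fst, x ∈ s :=
  (ae_map_iff measurable_fst.aemeasurable hs).symm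

theorem ae_snd_iff {s : Set Y} (hs : MeasurableSet s) :
    (∀ᵐ p ∂π, p.2 ∈ s) ↔ ∀ᵐ y ∂π.snd, y ∈ s :=
  (ae_map_iff measurable_snd.aemeasurable hs).symm

/-- Each condition involves one coordinate only, so it is a statement about a marginal. -/
theorem ae_fst_ne_bot_and_snd_ne_bot {u : X → EReal} {v : Y → EReal} (hu : Measurable u)
    (hv : Measurable v) {π' : Measure (X × Y)} (h₁ : π'.fst = π.fst) (h₂ : π'.snd = π.snd)
    (h : ∀ᵐ p ∂π, u p.1 ≠ ⊥ ∧ v p.2 ≠ ⊥) : ∀ᵐ p ∂π', u p.1 ≠ ⊥ ∧ v p.2 ≠ ⊥ := by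
  have hus : MeasurableSet {x | u x ≠ ⊥} := hu (measurableSet_singleton ⊥).compl
  have hvs : MeasurableSet {y | v y ≠ ⊥} := hv (measurableSet_singleton ⊥).compl
  have h1 : ∀ᵐ p ∂π', p.1 ∈ {x | u x ≠ ⊥} := by
    rw [ae_fst_iff hus, h₁, ← ae_fst_iff hus]
    exact h.mono fun p hp => hp.1
  have h2 : ∀ᵐ p ∂π', p.2 ∈ {y | v y ≠ ⊥} := by
    rw [ae_snd_iff hvs, h₂, ← ae_snd_iff hvs]
    exact h.mono fun p hp => hp.2
  filter_upwards [h1, h2] with p hp1 hp2 using ⟨hp1, hp2⟩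

theorem integrable_cost_iff (hc : Measurable c) :
    Integrable (fun p => (c p : ℝ)) π ↔ ∫⁻ p, (c p : ℝ≥0∞) ∂π < ⊤ := by
  rw [Integrable, and_iff_right (by fun_prop), HasFiniteIntegral]
  simp [enorm_eq_nnnorm]

theorem integral_cost (hc : Measurable c) :
    ∫ p, (c p : ℝ) ∂π = (∫⁻ p, (c p : ℝ≥0∞) ∂π).toReal := by
  rw [integral_eq_lintegral_of_nonneg_ae (ae_of_all _ fun p => NNReal.coe_nonneg _)
    (by fun_prop)]
  simp

/-- The plan witnessing `f` may differ from `π`, but both share marginals. Thus `f ⊕ f^c ≤ c` has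
equal integrals on both sides under `π`, which forces almost sure equality. -/
theorem IsKantorovichPotential.saturatesAE [IsFiniteMeasure μ] (hc : Measurable c)
    (hfm : Measurable f) (hgm : Measurable (cTransform c f)) (hT : transportCost c μ ν < ⊤)
    (hf : IsKantorovichPotential c μ ν f) (hπ : IsOptimalPlan c μ ν π) : SaturatesAE c π f := by
  obtain ⟨hcc, ρ, hρ, hbot, hint, heq⟩ := hf
  have := hπ.1.isFiniteMeasure
  have := hρ.1.isFiniteMeasure
  have h₁ : π.fst = ρ.fst := hπ.1.1.trans hρ.1.1.symm
  have h₂ : π.snd = ρ.snd := hπ.1.2.trans hρ.1.2.symm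
  have hbot' : ∀ᵐ p ∂ρ, f p.1 ≠ ⊥ ∧ cTransform c f p.2 ≠ ⊥ := by
    filter_upwards [hbot] with p hp
    rwa [Ne, EReal.add_eq_bot_iff, not_or] at hp
  have hfin := ae_fst_ne_bot_and_snd_ne_bot hfm hgm h₁ h₂ hbot'
  have hadd : (fun p : X × Y => (f p.1 + cTransform c f p.2).toReal) =ᵐ[ρ]
      fun p => (f p.1).toReal + (cTransform c f p.2).toReal := by
    filter_upwards [hbot'] with p hp
    exact EReal.toReal_add (hcc.1 _) hp.1 (cTransform_ne_top hcc.2.1 _) hp.2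
  have hle : ∀ᵐ p ∂π, (f p.1).toReal + (cTransform c f p.2).toReal ≤ c p := by
    filter_upwards [hfin] with p hp using hcc.toReal_add_le hp.1 hp.2
  have hci : Integrable (fun p => (c p : ℝ)) π := (integrable_cost_iff hc).2 (by rwa [hπ.2])
  obtain ⟨hi, hieq⟩ := integrable_add_and_integral_eq h₁ h₂ hfm.ereal_toReal hgm.ereal_toReal
    (fun p => NNReal.coe_nonneg (c p)) hci hle (hint.congr hadd)
  have htot : ∫ p, ((f p.1).toReal + (cTransform c f p.2).toReal) ∂π = ∫ p, (c p : ℝ) ∂π := by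
    rw [hieq, ← integral_congr_ae hadd, integral_cost hc, hπ.2, ← EReal.toReal_coe (∫ p, _ ∂ρ),
      heq, EReal.toReal_coe_ennreal]
  have := (integral_eq_iff_of_ae_le hi hci hle).1 htot
  filter_upwards [hfin, this] with p hp hp' using ⟨hp.1, hp.2, hp'⟩

/-- Any competitor of finite cost gives `f ⊕ f^c` the same integral as `π` does, and this integral
is at most the competitor's cost; hence `π` is optimal. -/
theorem SaturatesAE.isKantorovichPotential [IsFiniteMeasure μ] (hc : Measurable c)
    (hfm : Measurable f) (hgm : Measurable (cTransform c f)) (hcc : IsCConcave c f)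
    (hπ : IsPlan μ ν π) (hfin : ∫⁻ p, (c p : ℝ≥0∞) ∂π < ⊤) (h : SaturatesAE c π f) :
    IsKantorovichPotential c μ ν f := by
  have := hπ.isFiniteMeasure
  have hci := (integrable_cost_iff hc).2 hfin
  have hsum : (fun p : X × Y => (c p : ℝ)) =ᵐ[π]
      fun p => (f p.1).toReal + (cTransform c f p.2).toReal := by
    filter_upwards [h] with p hp using hp.2.2.symm
  have hadd : (fun p : X × Y => (f p.1 + cTransform c f p.2).toReal) =ᵐ[π] fun p => (c p : ℝ) := by
    filter_upwards [h] with p hp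
    rw [EReal.toReal_add (hcc.1 _) hp.1 (cTransform_ne_top hcc.2.1 _) hp.2.1, hp.2.2]
  have hopt : IsOptimalPlan c μ ν π := by
    refine ⟨hπ, le_antisymm (le_iInf₂ fun ρ hρ => ?_) (iInf₂_le π hπ)⟩
    by_cases hρtop : ∫⁻ p, (c p : ℝ≥0∞) ∂ρ = ⊤
    · rw [hρtop]; exact le_top
    have := hρ.isFiniteMeasure
    have h₁ : ρ.fst = π.fst := hρ.1.trans hπ.1.symm
    have h₂ : ρ.snd = π.snd := hρ.2.trans hπ.2.symm
    have hρi := (integrable_cost_iff hc).2 (lt_top_iff_ne_top.2 hρtop)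
    have hle : ∀ᵐ p ∂ρ, (f p.1).toReal + (cTransform c f p.2).toReal ≤ c p := by
      filter_upwards [ae_fst_ne_bot_and_snd_ne_bot hfm hgm h₁ h₂
        (h.mono fun p hp => ⟨hp.1, hp.2.1⟩)] with p hp using hcc.toReal_add_le hp.1 hp.2
    obtain ⟨hi, hieq⟩ := integrable_add_and_integral_eq h₁ h₂ hfm.ereal_toReal hgm.ereal_toReal
      (fun p => NNReal.coe_nonneg (c p)) hρi hle (hci.congr hsum)
    rw [← ENNReal.toReal_le_toReal hfin.ne hρtop, ← integral_cost hc, ← integral_cost hc,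
      integral_congr_ae hsum, ← hieq]
    exact integral_mono_ae hi hρi hle
  refine ⟨hcc, π, hopt, ?_, hci.congr hadd.symm, ?_⟩
  · filter_upwards [h] with p hp
    rw [Ne, EReal.add_eq_bot_iff, not_or]
    exact ⟨hp.1, hp.2.1⟩
  · rw [integral_congr_ae hadd, integral_cost hc, hopt.2, EReal.coe_ennreal_toReal]
    exact hopt.2 ▸ hfin.ne

end Optimality

/-! ### Restricting plans and potentials to a part of the source -/

section Restriction

variable {X Y : Type*} [MeasurableSpace X] [MeasurableSpace Y]
  {c : X × Y → ℝ≥0} {μ : Measure X} {ν : Measure Y} {π : Measure (X × Y)} {f : X → EReal}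
  {S : Set X}

/-- The plan between the marginals of the `S`-restricted problem induced by `π`. -/
noncomputable def restrictedPlan (μ : Measure X) (π : Measure (X × Y)) (S : Set X) :
    Measure (S × Y) :=
  (μ S)⁻¹ • π.comap (Prod.map Subtype.val id)

theorem measurableEmbedding_subtype_prodMap (hS : MeasurableSet S) :
    MeasurableEmbedding (Prod.map Subtype.val id : S × Y → X × Y) :=
  (MeasurableEmbedding.subtype_coe hS).prodMap MeasurableEmbedding.id

theorem isPlan_restrictedPlan (hS : MeasurableSet S) (hπ : IsPlan μ ν π) :
    IsPlan (restrictedSource μ S) (restrictedTarget μ π S) (restrictedPlan μ π S) := by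
  have he := measurableEmbedding_subtype_prodMap (Y := Y) hS
  constructor
  · rw [restrictedPlan, restrictedSource, Measure.fst, Measure.map_smul]
    congr 1
    ext t ht
    rw [Measure.map_apply measurable_fst ht, he.comap_apply,
      (MeasurableEmbedding.subtype_coe hS).comap_apply, ← hπ.1,
      Measure.fst_apply (hS.subtype_image ht)]
    congr 1
    ext ⟨x, y⟩
    simp
  · rw [restrictedPlan, restrictedTarget, Measure.snd, Measure.snd, Measure.map_smul]
    congr 1
    ext t ht
    rw [Measure.map_apply measurable_snd ht, he.comap_apply,
      Measure.map_apply measurable_snd ht, Measure.restrict_apply (measurable_snd ht)]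
    congr 1
    ext ⟨x, y⟩
    simp [and_comm]

theorem ae_restrictedPlan (hS : MeasurableSet S) {P : X × Y → Prop} (h : ∀ᵐ p ∂π, P p) :
    ∀ᵐ q ∂restrictedPlan μ π S, P ((q.1 : X), q.2) := by
  refine Measure.ae_smul_measure ?_ _
  have he := measurableEmbedding_subtype_prodMap (Y := Y) hS
  refine he.ae_map_iff.1 ?_
  rw [he.map_comap]
  exact ae_restrict_of_ae h

theorem lintegral_restrictedPlan_lt_top (hS : MeasurableSet S) (hS0 : μ S ≠ 0)
    (hfin : ∫⁻ p, (c p : ℝ≥0∞) ∂π < ⊤) :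
    ∫⁻ q, (restrictedCost c S q : ℝ≥0∞) ∂restrictedPlan μ π S < ⊤ := by
  have he := measurableEmbedding_subtype_prodMap (Y := Y) hS
  rw [restrictedPlan, lintegral_smul_measure]
  refine ENNReal.mul_lt_top (ENNReal.inv_lt_top.2 (pos_iff_ne_zero.2 hS0)) ?_
  calc ∫⁻ q, (restrictedCost c S q : ℝ≥0∞) ∂π.comap (Prod.map Subtype.val id : S × Y → X × Y)
      = ∫⁻ p, (c p : ℝ≥0∞) ∂(π.comap (Prod.map Subtype.val id : S × Y → X × Y)).map
          (Prod.map Subtype.val id) := (he.lintegral_map (fun p => (c p : ℝ≥0∞))).symm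
    _ ≤ ∫⁻ p, (c p : ℝ≥0∞) ∂π := by
        rw [he.map_comap]; exact setLIntegral_le_lintegral _ _
    _ < ⊤ := hfin

theorem ae_restrictedSource_iff (hS : MeasurableSet S) (hS' : μ S ≠ ⊤) {P : X → Prop} :
    (∀ᵐ x : S ∂restrictedSource μ S, P x) ↔ ∀ᵐ x ∂μ, x ∈ S → P x := by
  rw [restrictedSource, Measure.ae_ennreal_smul_measure_iff (ENNReal.inv_ne_zero.2 hS'),
    ← (MeasurableEmbedding.subtype_coe hS).ae_map_iff, map_comap_subtype_coe hS,
    ae_restrict_iff' hS]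

/-- An infimum over fewer points can only increase the transform, while the duality inequality still
caps the sum by `c`. Where equality held before, it persists. -/
theorem SaturatesAE.restrict [IsFiniteMeasure μ] (hS : MeasurableSet S) (hcc : IsCConcave c f)
    (h : SaturatesAE c π f) (hne : ∃ x ∈ S, f x ≠ ⊥) :
    SaturatesAE (restrictedCost c S) (restrictedPlan μ π S) (fun x : S => f x) := by
  filter_upwards [ae_restrictedPlan hS h] with q hq
  have hle := cTransform_le_restrictedCost (c := c) (f := f) S q.2
  have hne' : ∃ x : S, f x ≠ ⊥ := let ⟨x, hx, hfx⟩ := hne; ⟨⟨x, hx⟩, hfx⟩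
  have hbot : cTransform (restrictedCost c S) (fun x : S => f x) q.2 ≠ ⊥ := fun hb =>
    hq.2.1 (le_bot_iff.1 (hb ▸ hle))
  have htop := cTransform_ne_top (c := restrictedCost c S) hne' q.2
  refine ⟨hq.1, hbot, le_antisymm ?_ ?_⟩
  · exact (hcc.restrict hne).toReal_add_le hq.1 hbot
  · have := EReal.toReal_le_toReal hle hq.2.1 htop
    have h2 := hq.2.2
    simp only [restrictedCost]
    linarith

theorem IsKantorovichPotential.restrict [TopologicalSpace X] [BorelSpace X] [TopologicalSpace Y]
    [BorelSpace Y] [IsFiniteMeasure μ] (hc : Continuous c) (hcm : Measurable c)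
    (hT : transportCost c μ ν < ⊤) (hf : IsKantorovichPotential c μ ν f)
    (hπ : IsOptimalPlan c μ ν π) (hS : MeasurableSet S) (hS0 : μ S ≠ 0) :
    IsKantorovichPotential (restrictedCost c S) (restrictedSource μ S) (restrictedTarget μ π S)
      (fun x : S => f x) := by
  have hfm := hf.1.measurable hc
  have hsat := hf.saturatesAE hcm hfm (measurable_cTransform hc f) hT hπ
  -- `f` is finite almost surely and `S` has positive mass.
  have hne : ∃ x ∈ S, f x ≠ ⊥ := by
    by_contra! hcon
    have hfin : ∀ᵐ x ∂μ, f x ≠ ⊥ := by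
      rw [← hπ.1.1]
      exact (ae_fst_iff (hfm (measurableSet_singleton ⊥).compl)).1 (hsat.mono fun p hp => hp.1)
    exact hS0 (measure_mono_null (fun x hx => by simpa using hcon x hx) (ae_iff.1 hfin))
  have : IsFiniteMeasure (restrictedSource μ S) := by
    have : IsFiniteMeasure (μ.comap (Subtype.val : S → X)) := by
      refine ⟨?_⟩
      rw [(MeasurableEmbedding.subtype_coe hS).comap_apply]
      exact measure_lt_top _ _
    exact Measure.smul_finite _ (ENNReal.inv_ne_top.2 hS0)
  have hc' : Continuous (restrictedCost c S) :=
    hc.comp (continuous_subtype_val.prodMap continuous_id)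
  exact (hsat.restrict hS hf.1 hne).isKantorovichPotential
    (hcm.comp (measurable_subtype_coe.prodMap measurable_id)) (hfm.comp measurable_subtype_coe)
    (measurable_cTransform hc' _) (hf.1.restrict hne) (isPlan_restrictedPlan hS hπ.1)
    (lintegral_restrictedPlan_lt_top hS hS0 (hπ.2 ▸ hT))

end Restriction

/-! ### Connected components of the support -/

section Components

variable {Z I : Type*} [TopologicalSpace Z] {S : Set Z} {A : I → Set Z}

theorem isClosed_connectedComponentIn (hS : IsClosed S) (z : Z) :
    IsClosed (connectedComponentIn S z) := by
  by_cases hz : z ∈ S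
  · refine isClosed_of_closure_subset (IsPreconnected.subset_connectedComponentIn
      isPreconnected_connectedComponentIn.closure
      (subset_closure (mem_connectedComponentIn hz))
      (closure_minimal (connectedComponentIn_subset S z) hS))
  · simp [connectedComponentIn_eq_empty hz]

theorem IsComponentDecomposition.exists_eq (hA : IsComponentDecomposition S A) (i : I) :
    ∃ z ∈ S, A i = connectedComponentIn S z := by
  have h : A i ∈ range A := mem_range_self i
  rwa [hA.2] at h

theorem IsComponentDecomposition.isClosed (hA : IsComponentDecomposition S A) (hS : IsClosed S)
    (i : I) : IsClosed (A i) := by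
  obtain ⟨z, -, h⟩ := hA.exists_eq i
  exact h ▸ isClosed_connectedComponentIn hS z

theorem IsComponentDecomposition.iUnion_eq (hA : IsComponentDecomposition S A) :
    ⋃ i, A i = S := by
  refine subset_antisymm (iUnion_subset fun i => ?_) fun z hz => ?_
  · obtain ⟨z, -, h⟩ := hA.exists_eq i
    exact h ▸ connectedComponentIn_subset S z
  · have h : connectedComponentIn S z ∈ range A := hA.2 ▸ ⟨z, hz, rfl⟩
    obtain ⟨i, hi⟩ := h
    exact mem_iUnion.2 ⟨i, hi ▸ mem_connectedComponentIn hz⟩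

theorem IsComponentDecomposition.pairwise_disjoint (hA : IsComponentDecomposition S A) :
    Pairwise (Function.onFun Disjoint A) := by
  intro i j hij
  refine Set.disjoint_left.2 fun w hwi hwj => hij (hA.1 ?_)
  obtain ⟨z, -, h⟩ := hA.exists_eq i
  obtain ⟨z', -, h'⟩ := hA.exists_eq j
  rw [h] at hwi
  rw [h'] at hwj
  rw [h, h', connectedComponentIn_eq hwi, connectedComponentIn_eq hwj]

theorem IsComponentDecomposition.ae_mem_iUnion [HereditarilyLindelofSpace Z] [MeasurableSpace Z]
    {μ : Measure Z} (hA : IsComponentDecomposition μ.support A) : ∀ᵐ z ∂μ, z ∈ ⋃ i, A i := by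
  rw [hA.iUnion_eq]
  exact Measure.support_mem_ae

end Components

/-! ### Mass balance between components and non-degeneracy -/

section Partition

variable {X Y I J : Type*} [MeasurableSpace X] [MeasurableSpace Y] [Countable I] [Countable J]
  {μ : Measure X} {ν : Measure Y} {π : Measure (X × Y)} {A : I → Set X} {B : J → Set Y}

theorem measure_eq_tsum_inter {Z : Type*} [MeasurableSpace Z] {ρ : Measure Z} {C : I → Set Z}
    (hm : ∀ i, MeasurableSet (C i)) (hd : Pairwise (Function.onFun Disjoint C))
    (hae : ∀ᵐ z ∂ρ, z ∈ ⋃ i, C i) {s : Set Z} (hs : MeasurableSet s) :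
    ρ s = ∑' i, ρ (s ∩ C i) := by
  rw [← measure_iUnion (fun i j hij => (hd hij).mono inter_subset_right inter_subset_right)
    (fun i => hs.inter (hm i)), ← inter_iUnion]
  refine measure_congr ?_
  filter_upwards [hae] with z hz
  exact propext ⟨fun h => ⟨h, hz⟩, fun h => h.1⟩

theorem tsum_measure_subtype (hm : ∀ i, MeasurableSet (A i))
    (hd : Pairwise (Function.onFun Disjoint A)) (I' : Set I) :
    ∑' i : I', μ (A i) = μ (⋃ i ∈ I', A i) :=
  (measure_biUnion I'.to_countable (fun _ _ _ _ hij => hd hij) fun i _ => hm i).symm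

theorem IsPlan.measure_fst_eq_tsum (hπ : IsPlan μ ν π) (hB : ∀ j, MeasurableSet (B j))
    (hBd : Pairwise (Function.onFun Disjoint B)) (hBae : ∀ᵐ y ∂ν, y ∈ ⋃ j, B j)
    {s : Set X} (hs : MeasurableSet s) : μ s = ∑' j, π (s ×ˢ B j) := by
  have hae : ∀ᵐ p ∂π, p ∈ ⋃ j, Prod.snd ⁻¹' B j := by
    rw [← hπ.2] at hBae
    filter_upwards [(ae_snd_iff (MeasurableSet.iUnion hB)).2 hBae] with p hp
    simpa using hp
  rw [← hπ.1, Measure.fst_apply hs, measure_eq_tsum_inter (fun j => measurable_snd (hB j))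
    (fun i j hij => (hBd hij).preimage _) hae (measurable_fst hs)]
  rfl

theorem IsPlan.measure_snd_eq_tsum (hπ : IsPlan μ ν π) (hA : ∀ i, MeasurableSet (A i))
    (hAd : Pairwise (Function.onFun Disjoint A)) (hAae : ∀ᵐ x ∂μ, x ∈ ⋃ i, A i)
    {t : Set Y} (ht : MeasurableSet t) : ν t = ∑' i, π (A i ×ˢ t) := by
  have hae : ∀ᵐ p ∂π, p ∈ ⋃ i, Prod.fst ⁻¹' A i := by
    rw [← hπ.1] at hAae
    filter_upwards [(ae_fst_iff (MeasurableSet.iUnion hA)).2 hAae] with p hp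
    simpa using hp
  rw [← hπ.2, Measure.snd_apply ht, measure_eq_tsum_inter (fun i => measurable_fst (hA i))
    (fun i j hij => (hAd hij).preimage _) hae (measurable_snd ht)]
  exact tsum_congr fun i => congrArg π (inter_comm _ _)

theorem IsPlan.prod_le_snd (hπ : IsPlan μ ν π) {s : Set X} {t : Set Y} (ht : MeasurableSet t) :
    π (s ×ˢ t) ≤ ν t := by
  rw [← hπ.2, Measure.snd_apply ht]
  exact measure_mono fun p hp => hp.2

theorem IsPlan.prod_le_fst (hπ : IsPlan μ ν π) {s : Set X} {t : Set Y} (hs : MeasurableSet s) :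
    π (s ×ˢ t) ≤ μ s := by
  rw [← hπ.1, Measure.fst_apply hs]
  exact measure_mono fun p hp => hp.1

/-- A family of constants that agree whenever two components exchange mass with a common target
component is constant if the plan is not degenerate. -/
theorem exists_eq_of_not_isDegenerate [IsProbabilityMeasure μ] (hπ : IsPlan μ ν π)
    (hA : ∀ i, MeasurableSet (A i)) (hAd : Pairwise (Function.onFun Disjoint A))
    (hAae : ∀ᵐ x ∂μ, x ∈ ⋃ i, A i) (hB : ∀ j, MeasurableSet (B j))
    (hBd : Pairwise (Function.onFun Disjoint B)) (hBae : ∀ᵐ y ∂ν, y ∈ ⋃ j, B j)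
    (hdeg : ¬ IsDegenerate μ ν π A B) (a : I → ℝ)
    (hlink : ∀ i i' j, 0 < π (A i ×ˢ B j) → 0 < π (A i' ×ˢ B j) → a i = a i') :
    ∃ a₀, ∀ i, 0 < μ (A i) → a i = a₀ := by
  by_cases hex : ∃ i₀, 0 < μ (A i₀)
  swap
  · exact ⟨0, fun i hi => absurd ⟨i, hi⟩ hex⟩
  obtain ⟨i₀, hi₀⟩ := hex
  refine ⟨a i₀, ?_⟩
  -- Sources carrying the constant of `i₀`, and all targets they reach. By choice of `J'` no mass
  -- leaves `I'` for other targets; by `hlink` no mass enters `J'` from other sources.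
  set I' : Set I := {i | 0 < μ (A i) ∧ a i = a i₀} with hI'
  set J' : Set J := {j | ∃ i ∈ I', 0 < π (A i ×ˢ B j)} with hJ'
  have hμ : ∀ i : I', μ (A i) = ∑' j : J', π (A i ×ˢ B j) := fun i => by
    rw [hπ.measure_fst_eq_tsum hB hBd hBae (hA i)]
    refine (tsum_subtype_eq_of_support_subset (f := fun j => π (A i ×ˢ B j)) fun j hj => ?_).symm
    exact ⟨i, i.2, pos_iff_ne_zero.2 hj⟩
  have hν : ∀ j : J', ν (B j) = ∑' i : I', π (A i ×ˢ B j) := fun j => by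
    rw [hπ.measure_snd_eq_tsum hA hAd hAae (hB j)]
    refine (tsum_subtype_eq_of_support_subset (f := fun i => π (A i ×ˢ B j)) fun i hi => ?_).symm
    obtain ⟨k, hk, hkj⟩ := j.2
    have hi' := pos_iff_ne_zero.2 hi
    exact ⟨hi'.trans_le (hπ.prod_le_fst (hA i)), (hlink i k j hi' hkj).trans hk.2⟩
  have h1 : ∑' i : I', μ (A i) = ∑' i : I', ∑' j : J', π (A i ×ˢ B j) := tsum_congr hμ
  have h2 : ∑' i : I', ∑' j : J', π (A i ×ˢ B j) = ∑' j : J', ν (B j) := by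
    rw [ENNReal.tsum_comm]
    exact tsum_congr fun j => (hν j).symm
  have h0 : 0 < ∑' i : I', μ (A i) :=
    hi₀.trans_le (ENNReal.le_tsum (f := fun i : I' => μ (A i)) ⟨i₀, hi₀, rfl⟩)
  have hge : 1 ≤ ∑' i : I', μ (A i) := by
    rw [h1, h2]
    exact not_lt.1 fun hlt => hdeg ⟨I', J', h0, h1, h2, hlt⟩
  rw [tsum_measure_subtype hA hAd] at hge
  have hm : MeasurableSet (⋃ i ∈ I', A i) := MeasurableSet.biUnion I'.to_countable fun i _ => hA i
  have hnull : μ (⋃ i ∈ I', A i)ᶜ = 0 :=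
    (prob_compl_eq_zero_iff hm).2 (le_antisymm prob_le_one hge)
  intro i hi
  by_contra hne
  refine hi.ne' (measure_mono_null (fun x hx => ?_) hnull)
  simp only [mem_compl_iff, mem_iUnion, not_exists]
  intro k hk hxk
  have hik : i ≠ k := fun h => hne (h ▸ hk.2)
  exact Set.disjoint_left.1 (hAd hik) hx hxk

end Partition

/-! ### Equal constants for components sharing a target -/

section Linking

variable {X Y : Type*} [MeasurableSpace X] [MeasurableSpace Y]
  {c : X × Y → ℝ≥0} {μ : Measure X} {ν : Measure Y} {π : Measure (X × Y)} {f₁ f₂ : X → EReal}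

theorem SaturatesAE.ae_sub_eq (hπ : π.fst = μ)
    (h₁ : SaturatesAE c π f₁) (h₂ : SaturatesAE c π f₂) {s : Set X} {a : ℝ}
    (h : ∀ᵐ x ∂μ, x ∈ s → f₁ x - f₂ x = (a : EReal)) :
    ∀ᵐ p ∂π, p.1 ∈ s →
      (cTransform c f₂ p.2).toReal - (cTransform c f₁ p.2).toReal = a := by
  rw [← hπ] at h
  have h' := ae_of_ae_map measurable_fst.aemeasurable h
  filter_upwards [h₁, h₂, h'] with p hp₁ hp₂ hp hps
  have hsub := hp hps
  -- In `EReal`, `⊤ - ⊤ = ⊥`, so no difference involving `⊤` is a real number.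
  have t₁ : f₁ p.1 ≠ ⊤ := fun ht => by
    induction hx : f₂ p.1 using EReal.rec <;> simp_all
  have t₂ : f₂ p.1 ≠ ⊤ := fun ht => by simp_all
  have : (f₁ p.1).toReal - (f₂ p.1).toReal = a := by
    rw [← EReal.toReal_sub t₁ hp₁.1 t₂ hp₂.1, hsub, EReal.toReal_coe]
  linarith [hp₁.2.2, hp₂.2.2]

theorem eq_of_pos_of_singleton {d : Y → ℝ} {s s' : Set X} {y : Y} {a a' : ℝ}
    (h : ∀ᵐ p ∂π, p.1 ∈ s → d p.2 = a) (h' : ∀ᵐ p ∂π, p.1 ∈ s' → d p.2 = a')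
    (hs : 0 < π (s ×ˢ {y})) (hs' : 0 < π (s' ×ˢ {y})) : a = a' := by
  have key : ∀ {u : Set X} {r : ℝ}, (∀ᵐ p ∂π, p.1 ∈ u → d p.2 = r) → 0 < π (u ×ˢ {y}) →
      d y = r := by
    intro u r hr hu
    obtain ⟨p, hp, hpu⟩ := (frequently_ae_mem_iff.2 hu.ne').and_eventually hr |>.exists
    exact hp.2 ▸ hpu hp.1
  rw [← key h hs, ← key h' hs']

/-- A function that is continuous on a connected support and takes, almost surely, one of finitely
many values prescribed by the origin of the mass, only takes a single value. -/
theorem eq_of_pos_of_finite {I : Type*} [Countable I] [TopologicalSpace Y]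
    [HereditarilyLindelofSpace Y] [OpensMeasurableSpace Y] (hπ : π.snd = ν) {A : I → Set X}
    (hAae : ∀ᵐ p ∂π, p.1 ∈ ⋃ i, A i) {t : Set Y} (ht : IsClosed t) {d e : Y → ℝ}
    (hd : Measurable d) (he : ContinuousOn e t) (hde : EqOn d e t)
    (hconn : IsPreconnected (ν.restrict t).support) (hfin : {i | 0 < π (A i ×ˢ t)}.Finite)
    {a : I → ℝ} (ha : ∀ i, 0 < π (A i ×ˢ t) → ∀ᵐ p ∂π, p.1 ∈ A i → d p.2 = a i)
    {i i' : I} (hi : 0 < π (A i ×ˢ t)) (hi' : 0 < π (A i' ×ˢ t)) : a i = a i' := by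
  set F : Set ℝ := a '' {i | 0 < π (A i ×ˢ t)} with hF
  have hFfin : F.Finite := hfin.image a
  set K := (ν.restrict t).support with hK
  have hKt : K ⊆ t := (Measure.support_restrict_subset.trans inter_subset_left).trans
    ht.closure_eq.subset
  have hdF : ∀ᵐ y ∂ν, y ∈ tᶜ ∪ d ⁻¹' F := by
    have hmeas : MeasurableSet (tᶜ ∪ d ⁻¹' F) :=
      ht.measurableSet.compl.union (hd hFfin.measurableSet)
    rw [← hπ, ← ae_snd_iff hmeas]
    have h1 : ∀ᵐ p ∂π, ∀ k, p.1 ∈ A k → p.2 ∈ t → d p.2 ∈ F := by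
      refine ae_all_iff.2 fun k => ?_
      by_cases hk : 0 < π (A k ×ˢ t)
      · filter_upwards [ha k hk] with p hp hpk _ using ⟨k, hk, (hp hpk).symm⟩
      · have h0 : π (A k ×ˢ t) = 0 := by simpa using hk
        filter_upwards [measure_eq_zero_iff_ae_notMem.1 h0] with p hp hpk hpt
        exact absurd ⟨hpk, hpt⟩ hp
    filter_upwards [h1, hAae] with p hp hpA
    obtain ⟨k, hk⟩ := mem_iUnion.1 hpA
    by_cases hpt : p.2 ∈ t
    · exact Or.inr (hp k hk hpt)
    · exact Or.inl hpt
  -- Continuity of `e` on `t` makes this set closed; having full mass for `ν.restrict t`, it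
  -- contains the support. The almost sure statement thus becomes pointwise.
  have hKF : K ⊆ t ∩ e ⁻¹' F := by
    refine Measure.support_subset_of_isClosed
      (he.preimage_isClosed_of_isClosed ht hFfin.isClosed) ?_
    rw [mem_ae_iff, ← mem_ae_iff, ← eventually_mem_set, ae_restrict_iff' ht.measurableSet]
    filter_upwards [hdF] with y hy hyt
    rcases hy with hy | hy
    · exact absurd hyt hy
    · exact ⟨hyt, by rw [mem_preimage, ← hde hyt]; exact hy⟩
  obtain ⟨r, -, hr⟩ := hconn.eqOn_const_of_mapsTo hFfin.isDiscrete (he.mono hKt)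
    (fun y hy => (hKF hy).2) ⟨a i, i, hi, rfl⟩
  have hKae : ∀ᵐ p ∂π, p.2 ∈ t → p.2 ∈ K := by
    have h1 : ∀ᵐ y ∂ν, y ∈ t → y ∈ K :=
      (ae_restrict_iff' ht.measurableSet).1 Measure.support_mem_ae
    rw [← hπ] at h1
    exact ae_of_ae_map measurable_snd.aemeasurable h1
  have key : ∀ k, 0 < π (A k ×ˢ t) → a k = r := fun k hk => by
    obtain ⟨p, hp, hpd, hpK⟩ :=
      (frequently_ae_mem_iff.2 hk.ne').and_eventually ((ha k hk).and hKae) |>.exists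
    rw [← hpd hp.1, hde hp.2]
    exact hr (hpK hp.2)
  rw [key i hi, key i' hi']

end Linking

/-! ### Uniqueness of potentials and the discrete cases -/

section Main

variable {X Y I J : Type*}
  [TopologicalSpace X] [MeasurableSpace X] [BorelSpace X]
  [TopologicalSpace Y] [PolishSpace Y] [MeasurableSpace Y] [BorelSpace Y]
  {μ : Measure X} [IsProbabilityMeasure μ] {ν : Measure Y} {c : X × Y → ℝ≥0}
  {A : I → Set X} {B : J → Set Y}

/-- Continuity on a point is free. Finiteness holds because an almost sure property must hold at an
atom. -/
theorem componentwiseRegular_of_singleton (hc : Continuous c) (hT : transportCost c μ ν < ⊤)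
    (hB : ∀ j, 0 < ν (B j) → ∃ y, B j = {y}) : ComponentwiseRegular c μ ν B := by
  intro j hj
  obtain ⟨y, hy⟩ := hB j hj
  rw [hy] at hj ⊢
  refine ⟨fun f hf => ⟨fun z => (cTransform c f z).toReal, continuousOn_singleton _ _, ?_⟩, ?_⟩
  · rintro z rfl
    obtain ⟨π, hπ, -⟩ := hf.2
    have hm := measurable_cTransform hc f
    have hs := hf.saturatesAE hc.measurable (hf.1.measurable hc) hm hT hπ
    have hpos : 0 < π (Prod.snd ⁻¹' {z}) := by
      rwa [← hπ.1.2, Measure.snd_apply (measurableSet_singleton z)] at hj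
    obtain ⟨p, hp, hps⟩ := (frequently_ae_mem_iff.2 hpos.ne').and_eventually hs |>.exists
    have hpz : p.2 = z := hp
    exact (EReal.coe_toReal (cTransform_ne_top hf.1.2.1 z) (hpz ▸ hps.2.1)).symm
  · have hsub : (ν.restrict {y}).support ⊆ {y} :=
      (Measure.support_restrict_subset.trans inter_subset_left).trans
        isClosed_singleton.closure_eq.subset
    have hne : (ν.restrict {y}).support.Nonempty := by
      refine Measure.nonempty_support fun h => hj.ne' ?_
      rwa [Measure.restrict_eq_zero] at h
    rw [(subset_singleton_iff_eq.1 hsub).resolve_left hne.ne_empty]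
    exact isConnected_singleton

theorem potentialsAEUnique_of_subsingleton {X Y : Type*} [MeasurableSpace X] [MeasurableSpace Y]
    [Subsingleton X] (c : X × Y → ℝ≥0) (μ : Measure X) (ν : Measure Y) :
    PotentialsAEUnique c μ ν := by
  intro f₁ f₂ hf₁ hf₂
  obtain ⟨h₁, ⟨x₁, hx₁⟩, -⟩ := hf₁.1
  obtain ⟨h₂, ⟨x₂, hx₂⟩, -⟩ := hf₂.1
  refine ⟨(f₁ x₁).toReal - (f₂ x₂).toReal, ae_of_all _ fun x => ?_⟩
  rw [Subsingleton.elim x x₁, Subsingleton.elim x₂ x₁, EReal.coe_sub,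
    EReal.coe_toReal (h₁ _) hx₁, EReal.coe_toReal (h₂ _) (Subsingleton.elim x₂ x₁ ▸ hx₂)]

variable [PolishSpace X]

theorem potentialsAEUnique_of_not_isDegenerate [Countable I] [Countable J] (hc : Continuous c)
    (hT : transportCost c μ ν < ⊤) (hA : IsComponentDecomposition μ.support A)
    (hB : IsComponentDecomposition ν.support B) {π : Measure (X × Y)}
    (hπ : IsOptimalPlan c μ ν π) (hdeg : ¬ IsDegenerate μ ν π A B)
    (hres : ∀ i, 0 < μ (A i) → RestrictedPotentialsAEUnique c μ π (A i))
    (hreg : (ComponentwiseRegular c μ ν B ∧ ∀ j, {i | 0 < π (A i ×ˢ B j)}.Finite) ∨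
      (∀ j, 0 < ν (B j) → ∃ y, B j = {y})) :
    PotentialsAEUnique c μ ν := by
  intro f₁ f₂ hf₁ hf₂
  have hcm : Measurable c := hc.measurable
  have hAm : ∀ i, MeasurableSet (A i) := fun i =>
    (hA.isClosed Measure.isClosed_support i).measurableSet
  have hBc : ∀ j, IsClosed (B j) := hB.isClosed Measure.isClosed_support
  have hm₁ := measurable_cTransform hc f₁
  have hm₂ := measurable_cTransform hc f₂
  have hs₁ := hf₁.saturatesAE hcm (hf₁.1.measurable hc) hm₁ hT hπ
  have hs₂ := hf₂.saturatesAE hcm (hf₂.1.measurable hc) hm₂ hT hπ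
  have hconst : ∀ i, ∃ a : ℝ, 0 < μ (A i) →
      ∀ᵐ x ∂μ, x ∈ A i → f₁ x - f₂ x = (a : EReal) := by
    intro i
    by_cases hi : 0 < μ (A i)
    · obtain ⟨a, ha⟩ := hres i hi _ _ (hf₁.restrict hc hcm hT hπ (hAm i) hi.ne')
        (hf₂.restrict hc hcm hT hπ (hAm i) hi.ne')
      exact ⟨a, fun _ => (ae_restrictedSource_iff (P := fun x => f₁ x - f₂ x = (a : EReal)) (hAm i)
        (measure_ne_top _ _)).1 ha⟩
    -- Null components get an arbitrary constant, which never enters: linking involves only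
    -- components of positive mass.
    · exact ⟨0, fun h => absurd h hi⟩
  choose a ha using hconst
  set d : Y → ℝ := fun y => (cTransform c f₂ y).toReal - (cTransform c f₁ y).toReal with hd
  have hda : ∀ i, 0 < μ (A i) → ∀ᵐ p ∂π, p.1 ∈ A i → d p.2 = a i := fun i hi =>
    hs₁.ae_sub_eq hπ.1.1 hs₂ (ha i hi)
  have hpos : ∀ i j, 0 < π (A i ×ˢ B j) → 0 < μ (A i) := fun i j h =>
    h.trans_le (hπ.1.prod_le_fst (hAm i))
  have hAae : ∀ᵐ x ∂μ, x ∈ ⋃ i, A i := hA.ae_mem_iUnion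
  have hlink : ∀ i i' j, 0 < π (A i ×ˢ B j) → 0 < π (A i' ×ˢ B j) → a i = a i' := by
    intro i i' j hi hi'
    have hj : 0 < ν (B j) := hi.trans_le (hπ.1.prod_le_snd (hBc j).measurableSet)
    rcases hreg with ⟨hreg, hfin⟩ | hsing
    · obtain ⟨hcont, hconn⟩ := hreg j hj
      obtain ⟨g₁, hg₁, hfg₁⟩ := hcont f₁ hf₁
      obtain ⟨g₂, hg₂, hfg₂⟩ := hcont f₂ hf₂
      have hAae' : ∀ᵐ p ∂π, p.1 ∈ ⋃ i, A i := by
        rw [← hπ.1.1] at hAae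
        exact (ae_fst_iff (MeasurableSet.iUnion hAm)).2 hAae
      exact eq_of_pos_of_finite hπ.1.2 hAae' (hBc j) (d := d) (e := fun y => g₂ y - g₁ y)
        (hm₂.ereal_toReal.sub hm₁.ereal_toReal) (hg₂.sub hg₁)
        (fun y hy => by simp [hd, hfg₁ y hy, hfg₂ y hy]) hconn.isPreconnected (hfin j)
        (fun k hk => hda k (hpos k j hk)) hi hi'
    · obtain ⟨y, hy⟩ := hsing j hj
      have hi₀ := hpos i j hi
      have hi₀' := hpos i' j hi'
      rw [hy] at hi hi'
      exact eq_of_pos_of_singleton (hda i hi₀) (hda i' hi₀') hi hi'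
  obtain ⟨a₀, ha₀⟩ := exists_eq_of_not_isDegenerate hπ.1 hAm hA.pairwise_disjoint hAae
    (fun j => (hBc j).measurableSet) hB.pairwise_disjoint hB.ae_mem_iUnion hdeg a hlink
  refine ⟨a₀, ?_⟩
  have hall : ∀ᵐ x ∂μ, ∀ i, x ∈ A i → f₁ x - f₂ x = (a₀ : EReal) := by
    refine ae_all_iff.2 fun i => ?_
    by_cases hi : 0 < μ (A i)
    · exact ha₀ i hi ▸ ha i hi
    · have h0 : μ (A i) = 0 := by simpa using hi
      filter_upwards [measure_eq_zero_iff_ae_notMem.1 h0] with x hx hxi using absurd hxi hx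
  filter_upwards [hall, hAae] with x hx hxA
  obtain ⟨i, hi⟩ := mem_iUnion.1 hxA
  exact hx i hi

theorem potentialsAEUnique_of_countable [Countable I] [Countable J] (hc : Continuous c)
    (hT : transportCost c μ ν < ⊤) (hA : IsComponentDecomposition μ.support A)
    [IsProbabilityMeasure ν] (hB : IsComponentDecomposition ν.support B)
    (hAs : ∀ i, ∃ x, A i = {x}) (hBs : ∀ j, 0 < ν (B j) → ∃ y, B j = {y})
    (hne : ∀ (I' : Set I) (J' : Set J), I'.Nonempty → I' ≠ univ → J'.Nonempty → J' ≠ univ →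
      ∑' i : I', μ (A i) ≠ ∑' j : J', ν (B j)) :
    PotentialsAEUnique c μ ν := by
  intro f₁ f₂ hf₁ hf₂
  -- The potential itself supplies an optimal plan, so no existence theorem is needed.
  obtain ⟨π, hπ, -⟩ := hf₁.2
  refine potentialsAEUnique_of_not_isDegenerate hc hT hA hB hπ ?_ (fun i _ => ?_) (Or.inr hBs)
    f₁ f₂ hf₁ hf₂
  -- Common mass strictly between 0 and 1 makes both index sets nonempty and proper, contradicting
  -- `hne`.
  · rintro ⟨I', J', h0, h1, h2, hlt⟩
    have heq := h1.trans h2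
    refine hne I' J' ?_ ?_ ?_ ?_ heq
    · rw [nonempty_iff_ne_empty]
      rintro rfl
      simp at h0
    · rintro rfl
      rw [← heq, tsum_measure_subtype
        (fun i => (hA.isClosed Measure.isClosed_support i).measurableSet) hA.pairwise_disjoint,
        biUnion_univ, hA.iUnion_eq,
        (prob_compl_eq_zero_iff Measure.isClosed_support.measurableSet).1
          Measure.measure_compl_support] at hlt
      exact lt_irrefl _ hlt
    · rw [nonempty_iff_ne_empty]
      rintro rfl
      rw [heq] at h0
      simp at h0
    · rintro rfl
      rw [tsum_measure_subtype
        (fun j => (hB.isClosed Measure.isClosed_support j).measurableSet) hB.pairwise_disjoint,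
        biUnion_univ, hB.iUnion_eq,
        (prob_compl_eq_zero_iff Measure.isClosed_support.measurableSet).1
          Measure.measure_compl_support] at hlt
      exact lt_irrefl _ hlt
  · obtain ⟨x, hx⟩ := hAs i
    rw [hx]
    exact potentialsAEUnique_of_subsingleton _ _ _

end Main

end OptimalTransport

theorem mainTheorem2 {X Y I J : Type*}
    [TopologicalSpace X] [PolishSpace X] [MeasurableSpace X] [BorelSpace X]
    [TopologicalSpace Y] [PolishSpace Y] [MeasurableSpace Y] [BorelSpace Y]
    [Countable I] [Countable J]
    (μ : Measure X) [IsProbabilityMeasure μ] (ν : Measure Y) [IsProbabilityMeasure ν]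
    (c : X × Y → ℝ≥0) (hc : Continuous c)
    (hT : OptimalTransport.transportCost c μ ν < ⊤)
    (A : I → Set X) (hA : OptimalTransport.IsComponentDecomposition μ.support A)
    (B : J → Set Y) (hB : OptimalTransport.IsComponentDecomposition ν.support B) :
    -- uniqueness under either of the two additional assumptions
    (∀ π : Measure (X × Y), OptimalTransport.IsOptimalPlan c μ ν π →
      ¬ OptimalTransport.IsDegenerate μ ν π A B →
      (∀ i, 0 < μ (A i) → OptimalTransport.RestrictedPotentialsAEUnique c μ π (A i)) →
      ((OptimalTransport.ComponentwiseRegular c μ ν B ∧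
          ∀ j, {i | 0 < π (A i ×ˢ B j)}.Finite) ∨
        (∀ j, 0 < ν (B j) → ∃ y, B j = {y})) →
      OptimalTransport.PotentialsAEUnique c μ ν) ∧
    -- the second assumption always entails the regularity condition of the first
    ((∀ j, 0 < ν (B j) → ∃ y, B j = {y}) →
      OptimalTransport.ComponentwiseRegular c μ ν B) ∧
    -- countably discrete problems with non-degenerate marginals
    ((∀ i, ∃ x, A i = {x}) → (∀ j, 0 < ν (B j) → ∃ y, B j = {y}) →
      (∀ (I' : Set I) (J' : Set J), I'.Nonempty → I' ≠ univ → J'.Nonempty → J' ≠ univ →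
        ∑' i : I', μ (A i) ≠ ∑' j : J', ν (B j)) →
      OptimalTransport.PotentialsAEUnique c μ ν) := 
  ⟨fun _ hπ hdeg hres hreg => OptimalTransport.potentialsAEUnique_of_not_isDegenerate hc hT hA hB
      hπ hdeg hres hreg,
    fun hBs => OptimalTransport.componentwiseRegular_of_singleton hc hT hBs,
    fun hAs hBs hne => OptimalTransport.potentialsAEUnique_of_countable hc hT hA hB hAs hBs hne⟩
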